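/- Let $\beta\in\mathbb{R}$ be a (finite) inverse temperature. All systems have a separable Hilbert space, of finite or countably infinite dimension, with a Hamiltonian that has an eigenbasis and for which $\operatorname{tr} e^{-\beta H}<\infty$; write $\tau(\beta,H)=e^{-\beta H}/\operatorname{tr}(e^{-\beta H})$ for the Gibbs state. Fix a target system $\mathcal{S}$ of dimension at least $2$ with Hamiltonian $H_{\mathcal S}$, in the initial state $\varrho_{\mathcal S}=\tau(\beta,H_{\mathcal S})$. For $k\in\mathbb{N}$ let $\mathcal{M}_k$ be a machine with Hamiltonian $H_{\mathcal{M}_k}$ in the initial state $\varrho_{\mathcal{M}_k}=\tau(\beta,H_{\mathcal{M}_k})$, let $U_k$ be a unitary on $\mathcal{S}\mathcal{M}_k$, and put $$\varrho_{\mathcal{S}}^{(k)}=\operatorname{tr}_{\mathcal{M}_k}\!\big[U_k(\varrho_{\mathcal S}\otimes\varrho_{\mathcal{M}_k})U_k^\dagger\big],\qquad \varrho_{\mathcal{M}_k}'=\operatorname{tr}_{\mathcal{S}}\!\big[U_k(\varrho_{\mathcal S}\otimes\varrho_{\mathcal{M}_k})U_k^\dagger\big],\qquad \Delta E_k=\operatorname{tr}\!\big[H_{\mathcal{M}_k}(\varrho_{\mathcal{M}_k}'-\varrho_{\mathcal{M}_k})\big].$$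 Suppose that the target is perfectly cooled at the Landauer limit by these processes, i.e. 1. (perfect cooling) there are pure states $|\psi_k\rangle\!\langle\psi_k|$ of $\mathcal{S}$ with $\big\|\varrho_{\mathcal S}^{(k)}-|\psi_k\rangle\!\langle\psi_k|\big\|\to 0$ in operator norm; 2. (Landauer energy cost) the von Neumann entropies $S(\varrho_{\mathcal S})$ and $S(\varrho_{\mathcal S}^{(k)})$ are finite, the traces (taken in the energy eigenbases) defining $\Delta E_k$ converge, and the Landauer bound $\beta\,\Delta E_k\ge S(\varrho_{\mathcal S})-S(\varrho_{\mathcal S}^{(k)})$ is asymptotically saturated: $$\beta\,\Delta E_k-\big[S(\varrho_{\mathcal S})-S(\varrho_{\mathcal S}^{(k)})\big]\to 0 .$$ Then the machine must be infinite-dimensional and its maximal energy gap must diverge: $$\dim\mathcal{M}_k\to\infty\qquad\text{and}\qquad \omega_{\mathcal{M}_k}^{\max}:=\sup_{i,j}|\omega^{(k)}_j-\omega^{(k)}_i|\to\infty ,$$ where $\omega_i^{(k)}$ are the eigenvalues of $H_{\mathcal{M}_k}$, and where both quantities take values in $[0,\infty]$. (For a single machine, i.e. a constant sequence of machines, this says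 that the machine is infinite-dimensional and its maximal energy gap is infinite.) -/

import Mathlib

open Filter Topology
open scoped ENNReal InnerProductSpace

namespace LandauerCooling

noncomputable section

/-- The Hilbert space `ℓ²(ι)` of a quantum system whose Hamiltonian has a discrete spectrum, written
in coordinates with respect to an energy eigenbasis indexed by `ι`. The joint Hilbert space of two
systems with eigenbases indexed by `σ` and `ι` is `ℓ²(σ) ⊗ ℓ²(ι) = ℓ²(σ × ι)`. -/
abbrev Hilb (ι : Type*) : Type _ := lp (fun _ : ι => ℂ) 2

/-- Bounded operators on the Hilbert space of a system. -/
abbrev Op (ι : Type*) : Type _ := Hilb ι →L[ℂ] Hilb ι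

open scoped Classical in
/-- The basis vector `|x⟩`. -/
def ket {ι : Type*} (x : ι) : Hilb ι := lp.single 2 x (1 : ℂ)

theorem orthonormal_ket (ι : Type*) : Orthonormal ℂ (ket : ι → Hilb ι) := by
  classical
  rw [orthonormal_iff_ite]
  intro i j
  unfold ket
  rw [lp.inner_single_left, lp.single_apply]
  by_cases h : i = j
  · subst h
    simp
  · simp [h]

/-- The operator `∑ₓ w(x) |x⟩⟨x|`, for a summable family of weights `w`. -/
def diagOp {ι : Type*} (w : ι → ℝ) : Op ι :=
  ∑' x, (w x : ℂ) • InnerProductSpace.rankOne ℂ (ket x) (ket x)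

/-- The partition function `tr e^{-βH}` of the Hamiltonian `H = ∑ₙ ω(n) |n⟩⟨n|`. -/
def partitionFunction {ι : Type*} (β : ℝ) (ω : ι → ℝ) : ℝ :=
  ∑' n, Real.exp (-β * ω n)

/-- The eigenvalues of the Gibbs state. -/
def gibbsWeight {ι : Type*} (β : ℝ) (ω : ι → ℝ) (n : ι) : ℝ :=
  Real.exp (-β * ω n) / partitionFunction β ω

/-- The Gibbs state `τ(β, H) = e^{-βH} / tr e^{-βH}` of `H = ∑ₙ ω(n) |n⟩⟨n|`. -/
def gibbsState {ι : Type*} (β : ℝ) (ω : ι → ℝ) : Op ι :=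
  diagOp (gibbsWeight β ω)

/-- The uncorrelated joint state `τ(β, H_S) ⊗ τ(β, H_M)`. -/
def initialState {σ ι : Type*} (β : ℝ) (E : σ → ℝ) (ω : ι → ℝ) : Op (σ × ι) :=
  diagOp fun x => gibbsWeight β E x.1 * gibbsWeight β ω x.2

/-- The joint state `U (τ(β, H_S) ⊗ τ(β, H_M)) U†` after the unitary `U`. -/
def finalState {σ ι : Type*} (β : ℝ) (E : σ → ℝ) (ω : ι → ℝ) (U : unitary (Op (σ × ι))) :
    Op (σ × ι) :=
  (U : Op (σ × ι)) * initialState β E ω * star (U : Op (σ × ι))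

/-- The isometry `ψ ↦ ψ ⊗ |n⟩`. -/
def tensorKet {σ ι : Type*} (n : ι) : Hilb σ →L[ℂ] Hilb (σ × ι) :=
  ((orthonormal_ket (σ × ι)).comp (fun i : σ => (i, n))
    (Prod.mk_left_injective n)).orthogonalFamily.linearIsometry.toContinuousLinearMap

/-- The isometry `φ ↦ |i⟩ ⊗ φ`. -/
def ketTensor {σ ι : Type*} (i : σ) : Hilb ι →L[ℂ] Hilb (σ × ι) :=
  ((orthonormal_ket (σ × ι)).comp (fun n : ι => (i, n))
    (Prod.mk_right_injective i)).orthogonalFamily.linearIsometry.toContinuousLinearMap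

/-- The partial trace `tr_M ρ = ∑ₙ (1 ⊗ ⟨n|) ρ (1 ⊗ |n⟩)` over the second factor. The series
converges absolutely in operator norm when `ρ` is a density operator. -/
def traceSnd {σ ι : Type*} (ρ : Op (σ × ι)) : Op σ :=
  ∑' n : ι, (ContinuousLinearMap.adjoint (tensorKet n)) ∘L ρ ∘L (tensorKet n)

/-- The partial trace `tr_S ρ = ∑ᵢ (⟨i| ⊗ 1) ρ (|i⟩ ⊗ 1)` over the first factor. -/
def traceFst {σ ι : Type*} (ρ : Op (σ × ι)) : Op ι :=
  ∑' i : σ, (ContinuousLinearMap.adjoint (ketTensor i)) ∘L ρ ∘L (ketTensor i)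

/-- The operator `-T log T` given by the continuous functional calculus of a self-adjoint `T`. -/
def negMulLogOp {H : Type*} [NormedAddCommGroup H] [InnerProductSpace ℂ H] [CompleteSpace H]
    (T : H →L[ℂ] H) : H →L[ℂ] H :=
  cfc Real.negMulLog T

/-- The von Neumann entropy `-tr (ρ log ρ)` of a density operator, in nats, as the trace of the
positive operator `-ρ log ρ` in the energy eigenbasis. It may be infinite. -/
def entropy {ι : Type*} (ρ : Op ι) : ℝ≥0∞ :=
  ∑' i, ENNReal.ofReal (⟪ket i, negMulLogOp ρ (ket i)⟫_ℂ).re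

/-- `tr [H (ρ' - ρ)] = Δ` for `H = ∑ₙ ω(n) |n⟩⟨n|`, including convergence of the trace in the
energy eigenbasis (`H` may be unbounded). -/
def IsEnergyChange {ι : Type*} (ω : ι → ℝ) (ρ ρ' : Op ι) (Δ : ℝ) : Prop :=
  HasSum (fun n => ω n * (⟪ket n, (ρ' - ρ) (ket n)⟫_ℂ).re) Δ

/-- A sequence of states becomes asymptotically pure. -/
def PerfectCooling {σ : Type*} (ρ' : ℕ → Op σ) : Prop :=
  ∃ ψ : ℕ → Hilb σ, (∀ k, ‖ψ k‖ = 1) ∧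
    Tendsto (fun k => ‖ρ' k - InnerProductSpace.rankOne ℂ (ψ k) (ψ k)‖) atTop (𝓝 0)

/-- The Landauer bound `β ΔE_M ≥ S(ρ_S) - S(ρ_S')` is asymptotically saturated by the processes in
which the `k`-th machine, of energies `ω k`, interacts with the target through `U k`; the entropies
of the target and the energy changes of the machines are finite. -/
def LandauerCost {σ : Type*} {ι : ℕ → Type*} (β : ℝ) (E : σ → ℝ) (ω : ∀ k, ι k → ℝ)
    (U : ∀ k, unitary (Op (σ × ι k))) : Prop :=
  entropy (gibbsState β E) ≠ ∞ ∧
  (∀ k, entropy (traceSnd (finalState β E (ω k) (U k))) ≠ ∞) ∧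
  ∃ ΔE : ℕ → ℝ,
    (∀ k, IsEnergyChange (ω k) (gibbsState β (ω k))
      (traceFst (finalState β E (ω k) (U k))) (ΔE k)) ∧
    Tendsto (fun k => β * ΔE k - ((entropy (gibbsState β E)).toReal -
      (entropy (traceSnd (finalState β E (ω k) (U k)))).toReal)) atTop (𝓝 0)

/-- The maximal energy gap `sup_{i,j} |ω(j) - ω(i)|`, possibly infinite. -/
def maxEnergyGap {ι : Type*} (ω : ι → ℝ) : ℝ≥0∞ :=
  ⨆ i, ⨆ j, ENNReal.ofReal |ω j - ω i|

/-- The Hilbert space dimension of `ℓ²(ι)`, as the number of vectors of an orthonormal basis. -/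
def hilbertDim (ι : Type*) : ℕ∞ := ENat.card ι

end

end LandauerCooling

/-! Divergence of the gap needs only perfect cooling. Let the machine have dimension `d`. The joint
vectors whose target part is `ψ` span `d` dimensions, so a unitary can bring at most `d` of the
initial populations there, and every surplus population counts as impurity
(`mul_card_sub_card_le_norm`). A gap at most `C` forces `d` to be finite and all Gibbs weights to be
at least `exp (-|β| C) / d`. Two target levels then give `2 d` populations, and an impurity bounded
below independently of `d`.

For the dimension, suppose that dimensions at most `D` recur. The same counting makes the target
finite-dimensional. Let `h > 0` be the Shannon entropy of the target's Gibbs weights, `q` the Gibbs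
weights of the machine and `r` its final populations. Measuring the final state in a product basis
containing `ψ` gives `h + H(q) ≤ H(r) + o(1)` (`shannonEntropy_initial_le`), while `β ΔE = D(r‖q) +
H(r) - H(q)` (`mul_energyChange_eq`). Saturation therefore forces `D(r‖q)` to be small, so `r` is
close to `q` in Hellinger distance. In bounded dimension `H(r)` then cannot exceed `H(q)` by nearly
`h`: a contradiction. -/

namespace LandauerCooling

/-! ### Coordinates: diagonal operators, product vectors, partial traces. -/

section Kets

variable {σ ι : Type*}

theorem norm_ket (x : ι) : ‖(ket x : Hilb ι)‖ = 1 := (orthonormal_ket ι).1 x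

theorem inner_ket_left (x : ι) (v : Hilb ι) : ⟪ket x, v⟫_ℂ = v x := by
  classical
  unfold ket
  rw [lp.inner_single_left]
  simp

theorem inner_ket_ket [DecidableEq ι] (x y : ι) :
    ⟪(ket x : Hilb ι), ket y⟫_ℂ = if x = y then 1 else 0 :=
  orthonormal_iff_ite.1 (orthonormal_ket ι) x y

theorem hasSum_norm_inner_ket_sq (v : Hilb ι) :
    HasSum (fun x => ‖⟪ket x, v⟫_ℂ‖ ^ 2) (‖v‖ ^ 2) := by
  have h := Complex.hasSum_re (lp.hasSum_inner v v)
  have h2 : RCLike.re ⟪v, v⟫_ℂ = ‖v‖ ^ 2 := (norm_sq_eq_re_inner (𝕜 := ℂ) v).symm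
  rw [show (⟪v, v⟫_ℂ).re = ‖v‖ ^ 2 from h2] at h
  refine h.congr_fun ?_
  intro x
  rw [inner_ket_left]
  exact norm_sq_eq_re_inner (𝕜 := ℂ) (v x)

theorem norm_ketBra (x : ι) :
    ‖(InnerProductSpace.rankOne ℂ (ket x) (ket x) : Op ι)‖ = 1 := by
  rw [InnerProductSpace.norm_rankOne, norm_ket, one_mul]

theorem hasSum_diagOp {w : ι → ℝ} (hw : Summable w) :
    HasSum (fun x => (w x : ℂ) • (InnerProductSpace.rankOne ℂ (ket x) (ket x) : Op ι))
      (diagOp w) := by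
  refine Summable.hasSum (Summable.of_norm (hw.abs.congr fun x => ?_))
  rw [norm_smul, norm_ketBra, mul_one, Complex.norm_real, Real.norm_eq_abs]

theorem hasSum_diagOp_apply {w : ι → ℝ} (hw : Summable w) (v : Hilb ι) :
    HasSum (fun x => ((w x : ℂ) * ⟪ket x, v⟫_ℂ) • ket x) (diagOp w v) := by
  refine ((hasSum_diagOp hw).mapL (ContinuousLinearMap.apply ℂ (Hilb ι) v)).congr_fun
    fun x => ?_
  rw [mul_smul]
  rfl

theorem diagOp_ket {w : ι → ℝ} (hw : Summable w) (x : ι) :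
    diagOp w (ket x) = (w x : ℂ) • ket x := by
  classical
  refine (hasSum_diagOp_apply hw (ket x)).unique ?_
  convert hasSum_ite_eq x ((w x : ℂ) • (ket x : Hilb ι)) using 2 with y
  rw [inner_ket_ket]
  split_ifs with h
  · rw [h, mul_one]
  · simp

theorem hasSum_complex_inner_diagOp {w : ι → ℝ} (hw : Summable w) (v : Hilb ι) :
    HasSum (fun x => ((w x * ‖⟪ket x, v⟫_ℂ‖ ^ 2 : ℝ) : ℂ)) ⟪v, diagOp w v⟫_ℂ := by
  refine ((hasSum_diagOp_apply hw v).mapL (innerSL ℂ v)).congr_fun fun x => ?_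
  rw [innerSL_apply_apply, inner_smul_right, ← inner_conj_symm v (ket x), mul_assoc,
    Complex.mul_conj']
  push_cast
  rfl

theorem hasSum_inner_diagOp {w : ι → ℝ} (hw : Summable w) (v : Hilb ι) :
    HasSum (fun x => w x * ‖⟪ket x, v⟫_ℂ‖ ^ 2) (⟪v, diagOp w v⟫_ℂ).re :=
  Complex.hasSum_re (hasSum_complex_inner_diagOp hw v)

theorem isPositive_diagOp {w : ι → ℝ} (hw : Summable w) (h0 : ∀ x, 0 ≤ w x) :
    (diagOp w).IsPositive := by
  rw [ContinuousLinearMap.isPositive_iff_complex]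
  intro v
  have h := hasSum_inner_diagOp hw v
  have h1 : ⟪v, diagOp w v⟫_ℂ = ((⟪v, diagOp w v⟫_ℂ).re : ℂ) :=
    (hasSum_complex_inner_diagOp hw v).unique (Complex.hasSum_ofReal.2 h)
  have h2 : ⟪diagOp w v, v⟫_ℂ = ((⟪v, diagOp w v⟫_ℂ).re : ℂ) := by
    rw [← inner_conj_symm, h1, Complex.conj_ofReal, Complex.ofReal_re]
  rw [h2]
  refine ⟨by simp, ?_⟩
  rw [RCLike.re_eq_complex_re, Complex.ofReal_re]
  exact h.nonneg fun x => mul_nonneg (h0 x) (sq_nonneg _)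

theorem hasSum_tensorKet (n : ι) (v : Hilb σ) :
    HasSum (fun i => (v i) • (ket (i, n) : Hilb (σ × ι))) (tensorKet n v) :=
  ((orthonormal_ket (σ × ι)).comp (fun i : σ => (i, n))
    (Prod.mk_left_injective n)).orthogonalFamily.hasSum_linearIsometry v

theorem hasSum_ketTensor (i : σ) (v : Hilb ι) :
    HasSum (fun n => (v n) • (ket (i, n) : Hilb (σ × ι))) (ketTensor i v) :=
  ((orthonormal_ket (σ × ι)).comp (fun n : ι => (i, n))
    (Prod.mk_right_injective i)).orthogonalFamily.hasSum_linearIsometry v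

theorem tensorKet_ket (n : ι) (i : σ) : tensorKet n (ket i) = (ket (i, n) : Hilb (σ × ι)) := by
  classical
  refine (hasSum_tensorKet n _).unique ?_
  convert hasSum_ite_eq i (ket (i, n) : Hilb (σ × ι)) using 2 with y
  rw [← inner_ket_left, inner_ket_ket]
  split_ifs with h
  · rw [h, one_smul]
  · simp

theorem ketTensor_ket (i : σ) (n : ι) : ketTensor i (ket n) = (ket (i, n) : Hilb (σ × ι)) := by
  classical
  refine (hasSum_ketTensor i _).unique ?_
  convert hasSum_ite_eq n (ket (i, n) : Hilb (σ × ι)) using 2 with y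
  rw [← inner_ket_left, inner_ket_ket]
  split_ifs with h
  · rw [h, one_smul]
  · simp

theorem inner_tensorKet_same (n : ι) (u v : Hilb σ) :
    ⟪(tensorKet n u : Hilb (σ × ι)), tensorKet n v⟫_ℂ = ⟪u, v⟫_ℂ :=
  LinearIsometry.inner_map_map _ u v

theorem inner_tensorKet_of_ne {m n : ι} (hmn : m ≠ n) (u v : Hilb σ) :
    ⟪(tensorKet m u : Hilb (σ × ι)), tensorKet n v⟫_ℂ = 0 := by
  classical
  have key : ∀ (i : σ) , ⟪(ket (i, m) : Hilb (σ × ι)), tensorKet n v⟫_ℂ = 0 := by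
    intro i
    refine ((hasSum_tensorKet n v).mapL (innerSL ℂ (ket (i, m)))).unique ?_
    convert hasSum_zero using 2 with j
    simp [inner_ket_ket, hmn]
  rw [inner_eq_zero_symm]
  refine ((hasSum_tensorKet m u).mapL (innerSL ℂ (tensorKet n v))).unique ?_
  convert hasSum_zero using 2 with i
  simp only [innerSL_apply_apply, inner_smul_right]
  rw [inner_eq_zero_symm.1 (key i), mul_zero]

theorem orthonormal_tensorKet {α : Type*} {e : α → Hilb σ} (he : Orthonormal ℂ e) :
    Orthonormal ℂ fun y : α × ι => (tensorKet y.2 (e y.1) : Hilb (σ × ι)) := by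
  classical
  rw [orthonormal_iff_ite] at he ⊢
  rintro ⟨a, m⟩ ⟨b, n⟩
  by_cases h : m = n
  · subst h
    simp [inner_tensorKet_same, he]
  · simp [inner_tensorKet_of_ne h, h]

theorem inner_traceSnd [Fintype ι] (ρ : Op (σ × ι)) (v : Hilb σ) :
    ⟪v, traceSnd ρ v⟫_ℂ = ∑ n, ⟪tensorKet n v, ρ (tensorKet n v)⟫_ℂ := by
  simp [traceSnd, tsum_fintype, ContinuousLinearMap.adjoint_inner_right]

/-- The energy eigenbasis of a finite-dimensional system. -/
noncomputable def ketBasis (ι : Type*) [Fintype ι] : OrthonormalBasis ι ℂ (Hilb ι) :=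
  (HilbertBasis.ofRepr (LinearIsometryEquiv.refl ℂ (Hilb ι))).toOrthonormalBasis

theorem ketBasis_apply [Fintype ι] (x : ι) : ketBasis ι x = ket x := by
  rw [ketBasis, HilbertBasis.coe_toOrthonormalBasis]
  rfl

/-- Basis independence of the trace of the block of `ρ` at machine level `n`. It permits a target
basis adapted to the pure state instead of the energy eigenbasis. -/
theorem inner_ket_traceFst [Fintype σ] (ρ : Op (σ × ι)) (n : ι)
    (e : OrthonormalBasis σ ℂ (Hilb σ)) :
    ⟪ket n, traceFst ρ (ket n)⟫_ℂ = ∑ a, ⟪tensorKet n (e a), ρ (tensorKet n (e a))⟫_ℂ := by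
  set B : Op σ := ContinuousLinearMap.adjoint (tensorKet n) ∘L ρ ∘L tensorKet n with hB
  have h1 (v : Hilb σ) : ⟪v, B v⟫_ℂ = ⟪tensorKet n v, ρ (tensorKet n v)⟫_ℂ := by
    simp [hB, ContinuousLinearMap.adjoint_inner_right]
  have h2 := LinearMap.trace_eq_sum_inner (B : Hilb σ →ₗ[ℂ] Hilb σ) e
  rw [LinearMap.trace_eq_sum_inner (B : Hilb σ →ₗ[ℂ] Hilb σ) (ketBasis σ)] at h2
  simp only [ContinuousLinearMap.coe_coe, h1] at h2
  rw [← h2]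
  simp [traceFst, tsum_fintype, ContinuousLinearMap.adjoint_inner_right, ketTensor_ket,
    ketBasis_apply, tensorKet_ket]

end Kets

/-! ### Gibbs weights and bounded spectra. -/

section Gibbs

variable {ι : Type*} {β : ℝ} {ω : ι → ℝ}

theorem partitionFunction_pos [Nonempty ι] (hω : Summable fun n => Real.exp (-β * ω n)) :
    0 < partitionFunction β ω :=
  hω.tsum_pos (fun _ => (Real.exp_pos _).le) (Classical.arbitrary ι) (Real.exp_pos _)

theorem gibbsWeight_pos [Nonempty ι] (hω : Summable fun n => Real.exp (-β * ω n)) (n : ι) :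
    0 < gibbsWeight β ω n :=
  div_pos (Real.exp_pos _) (partitionFunction_pos hω)

theorem hasSum_gibbsWeight [Nonempty ι] (hω : Summable fun n => Real.exp (-β * ω n)) :
    HasSum (gibbsWeight β ω) 1 := by
  have h := hω.hasSum.div_const (partitionFunction β ω)
  rwa [show (∑' n, Real.exp (-β * ω n)) / partitionFunction β ω = 1 from
    div_self (partitionFunction_pos hω).ne'] at h

theorem log_gibbsWeight [Nonempty ι] (hω : Summable fun n => Real.exp (-β * ω n)) (n : ι) :
    Real.log (gibbsWeight β ω n) = -β * ω n - Real.log (partitionFunction β ω) := by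
  rw [gibbsWeight, Real.log_div (Real.exp_pos _).ne' (partitionFunction_pos hω).ne', Real.log_exp]

theorem gibbsWeight_le_exp_mul [Nonempty ι] (hω : Summable fun n => Real.exp (-β * ω n))
    {C : ℝ} {m n : ι} (hC : |ω m - ω n| ≤ C) :
    gibbsWeight β ω n ≤ Real.exp (|β| * C) * gibbsWeight β ω m := by
  unfold gibbsWeight
  rw [← mul_div_assoc, ← Real.exp_add]
  refine div_le_div_of_nonneg_right (Real.exp_le_exp.2 ?_) (partitionFunction_pos hω).le
  have h1 : β * (ω m - ω n) ≤ |β| * C := by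
    refine (le_abs_self _).trans ?_
    rw [abs_mul]
    exact mul_le_mul_of_nonneg_left hC (abs_nonneg β)
  linarith

/-- A discrete spectrum with finite partition function and bounded gaps is finite. -/
theorem finite_of_maxEnergyGap_ne_top (hω : Summable fun n => Real.exp (-β * ω n))
    (hgap : maxEnergyGap ω ≠ ∞) : Finite ι := by
  by_contra hfin
  rw [not_finite_iff_infinite] at hfin
  have hC (m n : ι) : |ω m - ω n| ≤ (maxEnergyGap ω).toReal := by
    rw [← ENNReal.ofReal_le_iff_le_toReal hgap]
    exact le_iSup_of_le n (le_iSup (fun j => ENNReal.ofReal |ω j - ω n|) m)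
  set n := Classical.arbitrary ι
  have h0 := hasSum_gibbsWeight hω
  -- On an infinite index set summable weights tend to zero, but bounded gaps keep them above a
  -- fixed positive multiple of the weight at `n`.
  have h1 := h0.summable.tendsto_cofinite_zero.const_mul
    (Real.exp (|β| * (maxEnergyGap ω).toReal))
  rw [mul_zero] at h1
  have h2 : gibbsWeight β ω n ≤ 0 :=
    ge_of_tendsto' h1 fun m => gibbsWeight_le_exp_mul hω (hC m n)
  exact h2.not_gt (gibbsWeight_pos hω n)

end Gibbs

/-! ### Joint evolution and the counting bound on purity. -/

section Joint

variable {σ ι : Type*} {β : ℝ} {E : σ → ℝ} {ω : ι → ℝ}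

theorem hasSum_jointWeight [Nonempty σ] [Nonempty ι]
    (hE : Summable fun i => Real.exp (-β * E i)) (hω : Summable fun n => Real.exp (-β * ω n)) :
    HasSum (fun x : σ × ι => gibbsWeight β E x.1 * gibbsWeight β ω x.2) 1 := by
  have h1 := hasSum_gibbsWeight hE
  have h2 := hasSum_gibbsWeight hω
  have h := h1.mul h2 (h1.summable.mul_of_nonneg h2.summable
    (fun i => (gibbsWeight_pos hE i).le) (fun n => (gibbsWeight_pos hω n).le))
  rwa [one_mul] at h

theorem hasSum_inner_finalState [Nonempty σ] [Nonempty ι]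
    (hE : Summable fun i => Real.exp (-β * E i)) (hω : Summable fun n => Real.exp (-β * ω n))
    (U : unitary (Op (σ × ι))) (v : Hilb (σ × ι)) :
    HasSum (fun x : σ × ι => gibbsWeight β E x.1 * gibbsWeight β ω x.2 *
      ‖⟪ket x, star (U : Op (σ × ι)) v⟫_ℂ‖ ^ 2) (⟪v, finalState β E ω U v⟫_ℂ).re := by
  have h := hasSum_inner_diagOp (hasSum_jointWeight hE hω).summable (star (U : Op (σ × ι)) v)
  rw [ContinuousLinearMap.star_eq_adjoint, ContinuousLinearMap.adjoint_inner_left] at h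
  exact h

theorem inner_star_unitary {H : Type*} [NormedAddCommGroup H] [InnerProductSpace ℂ H]
    [CompleteSpace H] (U : unitary (H →L[ℂ] H)) (u v : H) :
    ⟪star (U : H →L[ℂ] H) u, star (U : H →L[ℂ] H) v⟫_ℂ = ⟪u, v⟫_ℂ := by
  rw [ContinuousLinearMap.star_eq_adjoint, ContinuousLinearMap.adjoint_inner_left,
    ← ContinuousLinearMap.star_eq_adjoint, ← mul_apply_eq_comp,
    Unitary.mul_star_self_of_mem U.2, one_apply_eq_self]

theorem orthonormal_star_unitary {H α : Type*} [NormedAddCommGroup H] [InnerProductSpace ℂ H]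
    [CompleteSpace H] (U : unitary (H →L[ℂ] H)) {f : α → H} (hf : Orthonormal ℂ f) :
    Orthonormal ℂ fun a => star (U : H →L[ℂ] H) (f a) := by
  classical
  rw [orthonormal_iff_ite] at hf ⊢
  intro a b
  rw [inner_star_unitary, hf]

theorem abs_inner_sub_rankOne_le {T : Op σ} {ψ : Hilb σ} (hψ : ‖ψ‖ = 1) :
    |(⟪ψ, T ψ⟫_ℂ).re - 1| ≤ ‖T - InnerProductSpace.rankOne ℂ ψ ψ‖ := by
  have h : (⟪ψ, T ψ⟫_ℂ).re - 1 = (⟪ψ, (T - InnerProductSpace.rankOne ℂ ψ ψ) ψ⟫_ℂ).re := by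
    simp [inner_self_eq_norm_sq_to_K, hψ]
  rw [h]
  refine (Complex.abs_re_le_norm _).trans ((norm_inner_le_norm _ _).trans ?_)
  rw [hψ, one_mul]
  simpa [hψ] using (T - InnerProductSpace.rankOne ℂ ψ ψ).le_opNorm ψ

theorem abs_inner_sub_rankOne_le_of_inner_eq_zero {T : Op σ} {ψ e : Hilb σ} (he : ‖e‖ = 1)
    (h0 : ⟪ψ, e⟫_ℂ = 0) :
    |(⟪e, T e⟫_ℂ).re| ≤ ‖T - InnerProductSpace.rankOne ℂ ψ ψ‖ := by
  have h : (⟪e, T e⟫_ℂ).re = (⟪e, (T - InnerProductSpace.rankOne ℂ ψ ψ) e⟫_ℂ).re := by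
    simp [h0]
  rw [h]
  refine (Complex.abs_re_le_norm _).trans ((norm_inner_le_norm _ _).trans ?_)
  rw [he, one_mul]
  simpa [he] using (T - InnerProductSpace.rankOne ℂ ψ ψ).le_opNorm e

/-- A machine of dimension `d` can hold at most `d` of the populations of the initial state in the
support of a pure target state: populations outside bound the impurity of the target from below. -/
theorem mul_card_sub_card_le_norm [Nonempty σ] [Fintype ι] [Nonempty ι]
    (hE : Summable fun i => Real.exp (-β * E i)) (hω : Summable fun n => Real.exp (-β * ω n))
    (U : unitary (Op (σ × ι))) {ψ : Hilb σ} (hψ : ‖ψ‖ = 1) (T : Finset (σ × ι)) {c : ℝ}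
    (hc0 : 0 ≤ c) (hc : ∀ x ∈ T, c ≤ gibbsWeight β E x.1 * gibbsWeight β ω x.2) :
    c * (T.card - Fintype.card ι) ≤
      ‖traceSnd (finalState β E ω U) - InnerProductSpace.rankOne ℂ ψ ψ‖ := by
  set f : ι → Hilb (σ × ι) := fun n => star (U : Op (σ × ι)) (tensorKet n ψ) with hf
  have hfo : Orthonormal ℂ f := by
    have h := (orthonormal_tensorKet (ι := ι) (e := fun _ : Unit => ψ)
      ((orthonormal_subsingleton_iff).2 fun _ => hψ))
    exact orthonormal_star_unitary U (h.comp (fun n => ((), n)) fun m n h => by simpa using h)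
  -- `a x` is the weight of `ket x` in the span of the `f n`. Bessel's inequality, applied once to
  -- each orthonormal family, gives `a x ≤ 1` and a total over `T` of at most the dimension.
  set a : σ × ι → ℝ := fun x => ∑ n, ‖⟪ket x, f n⟫_ℂ‖ ^ 2 with ha
  have ha1 (x) : a x ≤ 1 := by
    have h := hfo.sum_inner_products_le (ket x) (s := Finset.univ)
    rw [norm_ket, one_pow] at h
    refine le_trans (le_of_eq (Finset.sum_congr rfl fun n _ => ?_)) h
    rw [norm_inner_symm]
  have haT : ∑ x ∈ T, a x ≤ Fintype.card ι := by
    rw [ha, Finset.sum_comm]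
    have h (n : ι) : ∑ x ∈ T, ‖⟪ket x, f n⟫_ℂ‖ ^ 2 ≤ 1 := by
      have h := (orthonormal_ket (σ × ι)).sum_inner_products_le (f n) (s := T)
      rwa [hfo.1 n, one_pow] at h
    refine (Finset.sum_le_sum fun n _ => h n).trans (by simp)
  have hsum : HasSum (fun x : σ × ι => gibbsWeight β E x.1 * gibbsWeight β ω x.2 * a x)
      (⟪ψ, traceSnd (finalState β E ω U) ψ⟫_ℂ).re := by
    rw [inner_traceSnd, Complex.re_sum]
    simp only [ha, Finset.mul_sum]
    exact hasSum_sum fun n _ => hasSum_inner_finalState hE hω U (tensorKet n ψ)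
  -- The infidelity is the sum of the populations weighted by `1 - a x`; all terms are nonnegative,
  -- so `T` alone bounds it from below.
  have hdiff := (hasSum_jointWeight hE hω).sub hsum
  have hw (x : σ × ι) : 0 ≤ gibbsWeight β E x.1 * gibbsWeight β ω x.2 :=
    mul_nonneg (gibbsWeight_pos hE _).le (gibbsWeight_pos hω _).le
  have h1 : c * (T.card - Fintype.card ι) ≤
      1 - (⟪ψ, traceSnd (finalState β E ω U) ψ⟫_ℂ).re := by
    calc c * (T.card - Fintype.card ι) ≤ c * (T.card - ∑ x ∈ T, a x) := by gcongr
      _ = ∑ x ∈ T, c * (1 - a x) := by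
        rw [← Finset.mul_sum, Finset.sum_sub_distrib]; simp
      _ ≤ ∑ x ∈ T, (gibbsWeight β E x.1 * gibbsWeight β ω x.2 -
            gibbsWeight β E x.1 * gibbsWeight β ω x.2 * a x) := by
        refine Finset.sum_le_sum fun x hx => ?_
        rw [← mul_one_sub]
        exact mul_le_mul_of_nonneg_right (hc x hx) (sub_nonneg.2 (ha1 x))
      _ ≤ _ := by
        refine sum_le_hasSum T (fun x _ => ?_) hdiff
        rw [← mul_one_sub]
        exact mul_nonneg (hw x) (sub_nonneg.2 (ha1 x))
  have h2 := abs_inner_sub_rankOne_le (T := traceSnd (finalState β E ω U)) hψ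
  linarith [neg_abs_le ((⟪ψ, traceSnd (finalState β E ω U) ψ⟫_ℂ).re - 1)]

end Joint

/-! ### Divergence of the gap, and finiteness of the target. -/

section Gap

theorem tendsto_maxEnergyGap_of_perfectCooling {σ : Type*} [Nontrivial σ]
    {β : ℝ} {E : σ → ℝ} (hE : Summable fun i => Real.exp (-β * E i))
    {ι : ℕ → Type*} [∀ k, Nonempty (ι k)]
    {ω : ∀ k, ι k → ℝ} (hω : ∀ k, Summable fun n => Real.exp (-β * ω k n))
    (U : ∀ k, unitary (Op (σ × ι k)))
    (hcool : PerfectCooling fun k => traceSnd (finalState β E (ω k) (U k))) :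
    Tendsto (fun k => maxEnergyGap (ω k)) atTop (𝓝 ⊤) := by
  classical
  obtain ⟨ψ, hψ, hlim⟩ := hcool
  rw [ENNReal.tendsto_nhds_top_iff_nnreal]
  intro C
  obtain ⟨i, j, hij⟩ := exists_pair_ne σ
  set p := min (gibbsWeight β E i) (gibbsWeight β E j) with hp
  have hp0 : 0 < p := lt_min (gibbsWeight_pos hE i) (gibbsWeight_pos hE j)
  -- This threshold equals `p * (exp (-|β| C) / d) * (2 d - d)`; it does not depend on the machine.
  have hc : 0 < p * Real.exp (-(|β| * C)) := mul_pos hp0 (Real.exp_pos _)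
  filter_upwards [hlim.eventually (gt_mem_nhds hc)] with k hk
  by_contra! hgap
  have hgap' : maxEnergyGap (ω k) ≠ ∞ := ne_top_of_le_ne_top ENNReal.coe_ne_top hgap
  have := finite_of_maxEnergyGap_ne_top (hω k) hgap'
  have := Fintype.ofFinite (ι k)
  have hC (m n : ι k) : |ω k m - ω k n| ≤ C := by
    rw [← ENNReal.ofReal_le_ofReal_iff C.coe_nonneg]
    refine le_trans (le_iSup_of_le n (le_iSup (fun j => ENNReal.ofReal |ω k j - ω k n|) m))
      (hgap.trans_eq (ENNReal.ofReal_coe_nnreal).symm)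
  set d : ℝ := (Fintype.card (ι k) : ℝ) with hd
  have hd0 : 0 < d := by rw [hd]; exact_mod_cast Fintype.card_pos
  -- The weights sum to one and differ by factors of at most `exp (|β| C)`, so none is far below the
  -- average `1 / d`.
  have hq (m : ι k) : Real.exp (-(|β| * C)) / d ≤ gibbsWeight β (ω k) m := by
    have h1 : (1 : ℝ) ≤ d * (Real.exp (|β| * C) * gibbsWeight β (ω k) m) := by
      rw [← (hasSum_gibbsWeight (hω k)).tsum_eq, tsum_fintype]
      refine (Finset.sum_le_sum fun n _ => gibbsWeight_le_exp_mul (hω k) (hC m n)).trans ?_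
      simp [hd]
    rw [div_le_iff₀ hd0, Real.exp_neg, inv_le_iff_one_le_mul₀' (Real.exp_pos _)]
    linarith
  have key := mul_card_sub_card_le_norm hE (hω k) (U k) (hψ k)
    (({i, j} : Finset σ) ×ˢ Finset.univ) (c := p * (Real.exp (-(|β| * C)) / d))
    (by positivity) (by
      rintro ⟨a, m⟩ hx
      have ha : p ≤ gibbsWeight β E a := by
        have : a = i ∨ a = j := by simpa using hx
        rcases this with rfl | rfl
        · exact min_le_left _ _
        · exact min_le_right _ _
      exact mul_le_mul ha (hq m) (by positivity) (gibbsWeight_pos hE a).le)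
  rw [Finset.card_product, Finset.card_pair hij, Finset.card_univ] at key
  have h2 : p * (Real.exp (-(|β| * C)) / d) * (((2 * Fintype.card (ι k) : ℕ) : ℝ) -
      Fintype.card (ι k)) = p * Real.exp (-(|β| * C)) := by
    push_cast
    rw [← hd]
    field_simp
    ring
  rw [h2] at key
  exact absurd hk (not_lt.2 key)

/-- If machines of bounded dimension occur again and again, the target is finite-dimensional. -/
theorem finite_target_of_frequently_card_le {σ : Type*} [Nonempty σ]
    {β : ℝ} {E : σ → ℝ} (hE : Summable fun i => Real.exp (-β * E i))
    {ι : ℕ → Type*} [∀ k, Nonempty (ι k)]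
    {ω : ∀ k, ι k → ℝ} (hω : ∀ k, Summable fun n => Real.exp (-β * ω k n))
    (U : ∀ k, unitary (Op (σ × ι k)))
    (hcool : PerfectCooling fun k => traceSnd (finalState β E (ω k) (U k)))
    {D : ℕ} (hD : ∃ᶠ k in atTop, hilbertDim (ι k) ≤ D) : Finite σ := by
  classical
  by_contra hfin
  rw [not_finite_iff_infinite] at hfin
  obtain ⟨ψ, hψ, hlim⟩ := hcool
  -- One level more than the machine has dimensions: paired with a single well-populated machine
  -- level, these give at least one surplus population.
  obtain ⟨K, hK⟩ := Infinite.exists_subset_card_eq σ (D + 1)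
  have hKne : K.Nonempty := Finset.card_pos.1 (by omega)
  set p := K.inf' hKne (gibbsWeight β E) with hp
  have hp0 : 0 < p := (Finset.lt_inf'_iff hKne).2 fun i _ => gibbsWeight_pos hE i
  have hc : 0 < p / (D + 1) := by positivity
  obtain ⟨k, hkD, hk⟩ := (hD.and_eventually (hlim.eventually (gt_mem_nhds hc))).exists
  have : Finite (ι k) := by
    rw [← ENat.card_lt_top]
    exact lt_of_le_of_lt hkD (ENat.natCast_lt_top D)
  have := Fintype.ofFinite (ι k)
  have hcard : Fintype.card (ι k) ≤ D := by
    rw [hilbertDim, ENat.card_eq_coe_fintype_card] at hkD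
    exact_mod_cast hkD
  obtain ⟨n, hn⟩ : ∃ n, 1 / ((D : ℝ) + 1) ≤ gibbsWeight β (ω k) n := by
    by_contra! h
    have h1 := (hasSum_gibbsWeight (hω k)).tsum_eq
    rw [tsum_fintype] at h1
    have h2 := Finset.sum_lt_sum_of_nonempty (Finset.univ_nonempty (α := ι k))
      (fun n _ => h n)
    rw [h1, Finset.sum_const, nsmul_eq_mul, Finset.card_univ, mul_one_div,
      lt_div_iff₀ (by positivity)] at h2
    have : (Fintype.card (ι k) : ℝ) ≤ D := by exact_mod_cast hcard
    linarith
  have key := mul_card_sub_card_le_norm hE (hω k) (U k) (hψ k)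
    (K ×ˢ {n}) (c := p * (1 / ((D : ℝ) + 1))) (by positivity) (by
      rintro ⟨a, m⟩ hx
      obtain ⟨ha, rfl⟩ : a ∈ K ∧ n = m := by simpa using hx
      exact mul_le_mul (Finset.inf'_le _ ha) hn (by positivity) (gibbsWeight_pos hE a).le)
  rw [Finset.card_product, hK, Finset.card_singleton, mul_one_div] at key
  have h2 : (Fintype.card (ι k) : ℝ) ≤ D := by exact_mod_cast hcard
  push_cast at key
  have h3 : p / (D + 1) * 1 ≤ p / (D + 1) * (((D : ℝ) + 1) * 1 - Fintype.card (ι k)) := by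
    apply mul_le_mul_of_nonneg_left _ hc.le
    linarith
  linarith

end Gap

/-! ### Classical entropy inequalities. -/

section Shannon

variable {α γ : Type*} [Fintype α] [Fintype γ]

/-- The Shannon entropy of a finite distribution, in nats. -/
noncomputable def shannonEntropy (p : α → ℝ) : ℝ := ∑ a, Real.negMulLog (p a)

theorem shannonEntropy_mul {p : α → ℝ} {q : γ → ℝ} (hp : ∑ a, p a = 1) (hq : ∑ c, q c = 1) :
    shannonEntropy (fun x : α × γ => p x.1 * q x.2) = shannonEntropy p + shannonEntropy q := by
  unfold shannonEntropy
  simp only [Real.negMulLog_mul, Finset.sum_add_distrib, Fintype.sum_prod_type,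
    ← Finset.sum_mul, ← Finset.mul_sum, hp, hq, one_mul]

/-- A doubly stochastic map increases the Shannon entropy. -/
theorem shannonEntropy_le_of_doublyStochastic {P : γ → α → ℝ} (hP : ∀ c a, 0 ≤ P c a)
    (hrow : ∀ c, ∑ a, P c a = 1) (hcol : ∀ a, ∑ c, P c a = 1) {w : α → ℝ} (hw : ∀ a, 0 ≤ w a) :
    shannonEntropy w ≤ shannonEntropy fun c => ∑ a, w a * P c a := by
  unfold shannonEntropy
  calc ∑ a, Real.negMulLog (w a) = ∑ a, (∑ c, P c a) * Real.negMulLog (w a) := by simp [hcol]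
    _ = ∑ c, ∑ a, P c a * Real.negMulLog (w a) := by
      simp only [Finset.sum_mul]
      exact Finset.sum_comm
    _ ≤ _ := Finset.sum_le_sum fun c _ => by
      have h := Real.concaveOn_negMulLog.le_map_sum (t := Finset.univ) (w := P c) (p := w)
        (fun a _ => hP c a) (hrow c) (fun a _ => hw a)
      simpa [mul_comm] using h

/-- This is `log x ≤ x - 1` at `x = t / r`, multiplied by `r`. The hypothesis `h0` excludes the case
where the convention `log 0 = 0` would make it fail. -/
theorem sub_le_negMulLog_add_mul_log {r t : ℝ} (hr : 0 ≤ r) (ht : 0 ≤ t) (h0 : t = 0 → r = 0) :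
    r - t ≤ -Real.negMulLog r - r * Real.log t := by
  rcases hr.eq_or_lt with rfl | hr
  · simpa using ht
  have ht' : 0 < t := ht.lt_of_ne fun h => hr.ne' (h0 h.symm)
  have h := mul_le_mul_of_nonneg_left (Real.log_le_sub_one_of_pos (div_pos ht' hr)) hr.le
  rw [Real.log_div ht'.ne' hr.ne', mul_sub, mul_sub, mul_div_cancel₀ _ hr.ne'] at h
  unfold Real.negMulLog
  linarith

/-- Subadditivity of the Shannon entropy. -/
theorem shannonEntropy_le_add_marginals {r : α × γ → ℝ} (hr : ∀ x, 0 ≤ r x)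
    (h1 : ∑ x, r x = 1) :
    shannonEntropy r ≤ (shannonEntropy fun a => ∑ c, r (a, c)) +
      shannonEntropy fun c => ∑ a, r (a, c) := by
  set s : α → ℝ := fun a => ∑ c, r (a, c) with hs
  set t : γ → ℝ := fun c => ∑ a, r (a, c) with ht
  have hs0 (a) : 0 ≤ s a := Finset.sum_nonneg fun c _ => hr _
  have ht0 (c) : 0 ≤ t c := Finset.sum_nonneg fun a _ => hr _
  have hs1 : ∑ a, s a = 1 := by rw [← h1, Fintype.sum_prod_type]
  have ht1 : ∑ c, t c = 1 := by rw [← h1, Fintype.sum_prod_type_right]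
  have hsr (a c) (h : s a = 0) : r (a, c) = 0 :=
    (Finset.sum_eq_zero_iff_of_nonneg fun c _ => hr (a, c)).1 h c (Finset.mem_univ c)
  have htr (a c) (h : t c = 0) : r (a, c) = 0 :=
    (Finset.sum_eq_zero_iff_of_nonneg fun a _ => hr (a, c)).1 h a (Finset.mem_univ a)
  -- Nonnegativity of the relative entropy of `r` to the product of its marginals, term by term.
  have key : ∑ x : α × γ, (r x - s x.1 * t x.2) ≤
      ∑ x : α × γ, (-Real.negMulLog (r x) - r x * Real.log (s x.1) - r x * Real.log (t x.2)) := by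
    refine Finset.sum_le_sum fun x _ => ?_
    obtain ⟨a, c⟩ := x
    have h := sub_le_negMulLog_add_mul_log (hr (a, c)) (mul_nonneg (hs0 a) (ht0 c))
      fun h => (mul_eq_zero.1 h).elim (hsr a c) (htr a c)
    by_cases h0 : r (a, c) = 0
    · simpa [h0] using h
    · rw [Real.log_mul (fun h => h0 (hsr a c h)) (fun h => h0 (htr a c h)), mul_add] at h
      dsimp only
      linarith
  have hS : ∑ x : α × γ, r x * Real.log (s x.1) = -shannonEntropy s := by
    rw [Fintype.sum_prod_type, shannonEntropy, ← Finset.sum_neg_distrib]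
    refine Finset.sum_congr rfl fun a _ => ?_
    dsimp only
    rw [← Finset.sum_mul, Real.negMulLog]
    ring
  have hT : ∑ x : α × γ, r x * Real.log (t x.2) = -shannonEntropy t := by
    rw [Fintype.sum_prod_type_right, shannonEntropy, ← Finset.sum_neg_distrib]
    refine Finset.sum_congr rfl fun c _ => ?_
    dsimp only
    rw [← Finset.sum_mul, Real.negMulLog]
    ring
  have hprod : ∑ x : α × γ, s x.1 * t x.2 = 1 := by
    rw [Fintype.sum_prod_type]
    simp only [← Finset.mul_sum, ht1, mul_one, hs1]
  simp only [Finset.sum_sub_distrib, Finset.sum_neg_distrib, h1, hprod, hS, hT] at key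
  unfold shannonEntropy at *
  linarith

/-- The relative entropy dominates the squared Hellinger distance. -/
theorem sum_sqrt_sub_sqrt_sq_le {p q : α → ℝ} (hp : ∀ a, 0 ≤ p a) (hq : ∀ a, 0 < q a)
    (hp1 : ∑ a, p a = 1) (hq1 : ∑ a, q a = 1) :
    ∑ a, (√(p a) - √(q a)) ^ 2 ≤ -shannonEntropy p - ∑ a, p a * Real.log (q a) := by
  have h (a) : (√(p a) - √(q a)) ^ 2 ≤
      q a - p a + (-Real.negMulLog (p a) - p a * Real.log (q a)) := by
    rcases (hp a).eq_or_lt with h0 | h0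
    · rw [← h0]
      simp [Real.sq_sqrt (hq a).le]
    -- Applying `log x ≤ x - 1` to the square root of `q a / p a` produces the cross term of the
    -- completed square.
    have h1 := Real.log_le_sub_one_of_pos (div_pos (Real.sqrt_pos.2 (hq a)) (Real.sqrt_pos.2 h0))
    rw [Real.log_div (Real.sqrt_pos.2 (hq a)).ne' (Real.sqrt_pos.2 h0).ne',
      Real.log_sqrt (hq a).le, Real.log_sqrt h0.le] at h1
    have h2 := mul_le_mul_of_nonneg_left h1 h0.le
    have h3 : p a * (√(q a) / √(p a) - 1) = √(p a) * √(q a) - p a := by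
      nth_rewrite 1 [← Real.mul_self_sqrt h0.le]
      have := (Real.sqrt_pos.2 h0).ne'
      field_simp
      rw [mul_sub, Real.mul_self_sqrt h0.le]
    rw [h3] at h2
    rw [sub_sq, Real.sq_sqrt h0.le, Real.sq_sqrt (hq a).le]
    unfold Real.negMulLog
    linarith
  refine (Finset.sum_le_sum fun a _ => h a).trans_eq ?_
  simp only [Finset.sum_add_distrib, Finset.sum_sub_distrib, Finset.sum_neg_distrib, hp1, hq1,
    shannonEntropy]
  ring

/-- A modulus of continuity of the Shannon entropy on distributions with at most `D` outcomes. -/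
theorem exists_shannonEntropy_lt_of_sum_sqrt_sub_sqrt_sq_lt (D : ℕ) {ε : ℝ} (hε : 0 < ε) :
    ∃ δ > 0, ∀ (α : Type*) [Fintype α] (p q : α → ℝ), Fintype.card α ≤ D → (∀ a, 0 ≤ p a) →
      (∀ a, 0 ≤ q a) → ∑ a, p a = 1 → ∑ a, q a = 1 → ∑ a, (√(p a) - √(q a)) ^ 2 < δ →
      shannonEntropy p < shannonEntropy q + ε := by
  -- Hellinger distance compares square roots, so `negMulLog` is composed with squaring and made
  -- uniformly continuous on the compact interval.
  have hcont : ContinuousOn (fun y : ℝ => Real.negMulLog (y ^ 2)) (Set.Icc 0 1) :=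
    (Real.continuous_negMulLog.comp (continuous_pow 2)).continuousOn
  have hunif := isCompact_Icc.uniformContinuousOn_of_continuous hcont
  rw [Metric.uniformContinuousOn_iff] at hunif
  have hε' : 0 < ε / (D + 1) := by positivity
  obtain ⟨δ, hδ, h⟩ := hunif _ hε'
  refine ⟨δ ^ 2, by positivity, fun α _ p q hD hp hq hp1 hq1 hpq => ?_⟩
  have hmem {f : α → ℝ} (hf : ∀ a, 0 ≤ f a) (hf1 : ∑ a, f a = 1) (a : α) :
      √(f a) ∈ Set.Icc (0 : ℝ) 1 := by
    refine ⟨Real.sqrt_nonneg _, Real.sqrt_le_one.2 ?_⟩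
    rw [← hf1]
    exact Finset.single_le_sum (fun a _ => hf a) (Finset.mem_univ a)
  have hterm (a : α) : Real.negMulLog (p a) ≤ Real.negMulLog (q a) + ε / (D + 1) := by
    have h1 : (√(p a) - √(q a)) ^ 2 < δ ^ 2 :=
      lt_of_le_of_lt (Finset.single_le_sum (f := fun a => (√(p a) - √(q a)) ^ 2)
        (fun a _ => sq_nonneg _) (Finset.mem_univ a)) hpq
    have h2 := h _ (hmem hp hp1 a) _ (hmem hq hq1 a) (by
      rw [Real.dist_eq]; exact abs_lt_of_sq_lt_sq h1 hδ.le)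
    rw [Real.sq_sqrt (hp a), Real.sq_sqrt (hq a), Real.dist_eq] at h2
    linarith [le_abs_self (Real.negMulLog (p a) - Real.negMulLog (q a))]
  have hsum := Finset.sum_le_sum fun a (_ : a ∈ Finset.univ) => hterm a
  rw [Finset.sum_add_distrib, Finset.sum_const, nsmul_eq_mul, Finset.card_univ] at hsum
  have hD' : (Fintype.card α : ℝ) ≤ D := by exact_mod_cast hD
  have h3 : Fintype.card α * (ε / (D + 1)) < ε := by
    rw [← mul_div_assoc, div_lt_iff₀ (by positivity)]
    nlinarith
  unfold shannonEntropy
  linarith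

/-- Distributions close to a deterministic one have small Shannon entropy. -/
theorem exists_shannonEntropy_lt_of_nearly_deterministic (α : Type*) [Fintype α] {ε : ℝ}
    (hε : 0 < ε) :
    ∃ δ > 0, ∀ (p : α → ℝ) (a₀ : α), |p a₀ - 1| < δ → (∀ a, a ≠ a₀ → |p a| < δ) →
      shannonEntropy p < ε := by
  -- `negMulLog` vanishes at both 0 and 1, so continuity there bounds each term by this share of
  -- `ε`.
  have hε' : 0 < ε / (Fintype.card α + 1) := by positivity
  obtain ⟨δ₀, hδ₀, h₀⟩ := Metric.continuousAt_iff.1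
    (Real.continuous_negMulLog.continuousAt (x := 0)) _ hε'
  obtain ⟨δ₁, hδ₁, h₁⟩ := Metric.continuousAt_iff.1
    (Real.continuous_negMulLog.continuousAt (x := 1)) _ hε'
  refine ⟨min δ₀ δ₁, lt_min hδ₀ hδ₁, fun p a₀ hp1 hp0 => ?_⟩
  have hterm (a : α) : Real.negMulLog (p a) ≤ ε / (Fintype.card α + 1) := by
    by_cases ha : a = a₀
    · have h := h₁ (x := p a) (by
        rw [Real.dist_eq, ha]; exact hp1.trans_le (min_le_right _ _))
      rw [Real.dist_eq, Real.negMulLog_one, sub_zero] at h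
      exact ((le_abs_self _).trans_lt h).le
    · have h := h₀ (x := p a) (by
        rw [Real.dist_eq, sub_zero]; exact (hp0 a ha).trans_le (min_le_left _ _))
      rw [Real.dist_eq, Real.negMulLog_zero, sub_zero] at h
      exact ((le_abs_self _).trans_lt h).le
  refine (Finset.sum_le_sum fun a _ => hterm a).trans_lt ?_
  rw [Finset.sum_const, nsmul_eq_mul, Finset.card_univ, ← mul_div_assoc,
    div_lt_iff₀ (by positivity)]
  nlinarith

end Shannon

/-! ### Von Neumann entropy of the initial target state. -/

section Entropy

variable {σ : Type*} [Fintype σ] {β : ℝ} {E : σ → ℝ}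

theorem negMulLog_le_tangent {x c : ℝ} (hx : 0 ≤ x) (hc : 0 < c) :
    Real.negMulLog x ≤ c - (Real.log c + 1) * x := by
  have h := sub_le_negMulLog_add_mul_log hx hc.le fun h => absurd h hc.ne'
  linarith

/-- The concave function `negMulLog` lies below its tangent at `c`, and the functional calculus is
monotone. The tangent is affine, so its value on the eigenvector is explicit and equals `negMulLog
c`. -/
theorem inner_negMulLogOp_le_of_eigenvector {H : Type*} [NormedAddCommGroup H]
    [InnerProductSpace ℂ H] [CompleteSpace H] {T : H →L[ℂ] H} (hT : T.IsPositive) {c : ℝ}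
    (hc : 0 < c) {v : H} (hv : ‖v‖ = 1) (hTv : T v = (c : ℂ) • v) :
    (⟪v, negMulLogOp T v⟫_ℂ).re ≤ Real.negMulLog c := by
  have hpos : 0 ≤ T := (ContinuousLinearMap.nonneg_iff_isPositive _).2 hT
  have hsa : IsSelfAdjoint T := hT.isSelfAdjoint
  have hle : negMulLogOp T ≤ cfc (fun x : ℝ => c - (Real.log c + 1) * x) T :=
    cfc_mono (fun x hx => negMulLog_le_tangent (spectrum_nonneg_of_nonneg hpos hx) hc)
      Real.continuous_negMulLog.continuousOn
  have heq : cfc (fun x : ℝ => c - (Real.log c + 1) * x) T =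
      algebraMap ℝ (H →L[ℂ] H) c - (Real.log c + 1) • T := by
    rw [cfc_sub (fun _ : ℝ => c) (fun x : ℝ => (Real.log c + 1) * x) T, cfc_const c T,
      cfc_const_mul_id (Real.log c + 1) T]
  rw [heq] at hle
  have h := ((ContinuousLinearMap.le_def _ _).1 hle).re_inner_nonneg_right v
  have h2 : ⟪v, (algebraMap ℝ (H →L[ℂ] H) c - (Real.log c + 1) • T) v⟫_ℂ =
      ((Real.negMulLog c : ℝ) : ℂ) := by
    rw [Algebra.algebraMap_eq_smul_one]
    simp only [sub_apply, smul_apply, hTv, one_apply_eq_self, inner_sub_right]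
    rw [← Complex.coe_smul c v, ← Complex.coe_smul (Real.log c + 1)]
    simp only [inner_smul_right, inner_self_eq_norm_sq_to_K, hv, Real.negMulLog]
    push_cast
    simp
    ring
  rw [sub_apply, inner_sub_right, h2] at h
  simp only [RCLike.re_eq_complex_re, Complex.sub_re, Complex.ofReal_re] at h
  linarith

theorem inner_negMulLogOp_diagOp_le {w : σ → ℝ} (hw : ∀ i, 0 < w i) (i : σ) :
    (⟪ket i, negMulLogOp (diagOp w) (ket i)⟫_ℂ).re ≤ Real.negMulLog (w i) :=
  have hs : Summable w := (hasSum_fintype w).summable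
  inner_negMulLogOp_le_of_eigenvector (isPositive_diagOp hs fun i => (hw i).le) (hw i)
    (norm_ket i) (diagOp_ket hs i)

/-- Only this direction is needed: it turns saturation into an upper bound on the energy cost. -/
theorem toReal_entropy_gibbsState_le [Nonempty σ] (hE : Summable fun i => Real.exp (-β * E i)) :
    (entropy (gibbsState β E)).toReal ≤ shannonEntropy (gibbsWeight β E) := by
  have hle1 (i : σ) : gibbsWeight β E i ≤ 1 :=
    le_hasSum (hasSum_gibbsWeight hE) i fun j _ => (gibbsWeight_pos hE j).le
  have hnn (i : σ) : 0 ≤ Real.negMulLog (gibbsWeight β E i) :=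
    Real.negMulLog_nonneg (gibbsWeight_pos hE i).le (hle1 i)
  refine ENNReal.toReal_le_of_le_ofReal (Finset.sum_nonneg fun i _ => hnn i) ?_
  rw [entropy, tsum_fintype, shannonEntropy, ENNReal.ofReal_sum_of_nonneg fun i _ => hnn i]
  exact Finset.sum_le_sum fun i _ => ENNReal.ofReal_le_ofReal
    (inner_negMulLogOp_diagOp_le (gibbsWeight_pos hE) i)

theorem shannonEntropy_gibbsWeight_pos [Nontrivial σ]
    (hE : Summable fun i => Real.exp (-β * E i)) : 0 < shannonEntropy (gibbsWeight β E) := by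
  have hlt (i : σ) : gibbsWeight β E i < 1 := by
    obtain ⟨j, hj⟩ := exists_ne i
    have h1 := (hasSum_gibbsWeight hE).tsum_eq
    rw [tsum_fintype] at h1
    rw [← h1]
    exact Finset.single_lt_sum hj (Finset.mem_univ i) (Finset.mem_univ j) (gibbsWeight_pos hE j)
      fun k _ _ => (gibbsWeight_pos hE k).le
  refine Finset.sum_pos (fun i _ => ?_) Finset.univ_nonempty
  have h := mul_pos (gibbsWeight_pos hE i) (neg_pos.2
    (Real.log_neg (gibbsWeight_pos hE i) (hlt i)))
  unfold Real.negMulLog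
  linarith

end Entropy

/-! ### Entropy and energy balance of a finite-dimensional process. -/

section FiniteProcess

variable {σ ι : Type*} [Fintype σ] {β : ℝ} {E : σ → ℝ} {ω : ι → ℝ}

theorem exists_orthonormalBasis_apply_eq [Nonempty σ] {ψ : Hilb σ} (hψ : ‖ψ‖ = 1) :
    ∃ (e : OrthonormalBasis σ ℂ (Hilb σ)) (a₀ : σ), e a₀ = ψ := by
  set a₀ := Classical.arbitrary σ
  have hcard : Module.finrank ℂ (Hilb σ) = Fintype.card σ :=
    Module.finrank_eq_card_basis (ketBasis σ).toBasis
  have := Module.Basis.finiteDimensional_of_finite (ketBasis σ).toBasis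
  have hv : Orthonormal ℂ (({a₀} : Set σ).domRestrict fun _ => ψ) :=
    (orthonormal_subsingleton_iff).2 fun _ => hψ
  obtain ⟨e, he⟩ := hv.exists_orthonormalBasis_extension_of_card_eq hcard
  exact ⟨e, a₀, he a₀ rfl⟩

/-- The joint distribution of the outcomes of measuring the target in the basis `e` and the machine
in its energy eigenbasis. -/
noncomputable def jointOutcome (e : OrthonormalBasis σ ℂ (Hilb σ)) (ρ : Op (σ × ι))
    (y : σ × ι) : ℝ :=
  (⟪tensorKet y.2 (e y.1), ρ (tensorKet y.2 (e y.1))⟫_ℂ).re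

theorem sum_jointOutcome_fst (e : OrthonormalBasis σ ℂ (Hilb σ)) (ρ : Op (σ × ι)) (n : ι) :
    ∑ a, jointOutcome e ρ (a, n) = (⟪ket n, traceFst ρ (ket n)⟫_ℂ).re := by
  rw [inner_ket_traceFst ρ n e, Complex.re_sum]
  rfl

variable [Fintype ι]

theorem sum_jointOutcome_snd (e : OrthonormalBasis σ ℂ (Hilb σ)) (ρ : Op (σ × ι)) (a : σ) :
    ∑ n, jointOutcome e ρ (a, n) = (⟪e a, traceSnd ρ (e a)⟫_ℂ).re := by
  rw [inner_traceSnd, Complex.re_sum]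
  rfl

/-- The probabilities of the transitions induced by `U†`. -/
noncomputable def transitionProb (e : OrthonormalBasis σ ℂ (Hilb σ)) (U : unitary (Op (σ × ι)))
    (y x : σ × ι) : ℝ :=
  ‖⟪ket x, star (U : Op (σ × ι)) (tensorKet y.2 (e y.1))⟫_ℂ‖ ^ 2

theorem sum_transitionProb_right (e : OrthonormalBasis σ ℂ (Hilb σ)) (U : unitary (Op (σ × ι)))
    (y : σ × ι) : ∑ x, transitionProb e U y x = 1 := by
  have hfo := orthonormal_star_unitary U (orthonormal_tensorKet (ι := ι) e.orthonormal)
  have h := (hasSum_norm_inner_ket_sq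
    (star (U : Op (σ × ι)) (tensorKet y.2 (e y.1)))).tsum_eq
  rw [tsum_fintype, hfo.1 y, one_pow] at h
  exact h

/-- Bessel's inequality bounds each column sum by one; since the row sums are one, the columns total
their number, so every bound is attained. -/
theorem sum_transitionProb_left (e : OrthonormalBasis σ ℂ (Hilb σ)) (U : unitary (Op (σ × ι)))
    (x : σ × ι) : ∑ y, transitionProb e U y x = 1 := by
  have hfo := orthonormal_star_unitary U (orthonormal_tensorKet (ι := ι) e.orthonormal)
  have hle (x : σ × ι) : ∑ y, transitionProb e U y x ≤ 1 := by
    have h := hfo.sum_inner_products_le (ket x) (s := Finset.univ)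
    rw [norm_ket, one_pow] at h
    refine le_trans (le_of_eq (Finset.sum_congr rfl fun y _ => ?_)) h
    rw [norm_inner_symm]
    rfl
  have htot : ∑ x, ∑ y, transitionProb e U y x = ∑ _x : σ × ι, (1 : ℝ) := by
    rw [Finset.sum_comm]
    exact Finset.sum_congr rfl fun y _ => sum_transitionProb_right e U y
  exact (Finset.sum_eq_sum_iff_of_le fun x _ => hle x).1 htot x (Finset.mem_univ x)

variable [Nonempty σ] [Nonempty ι]

theorem jointOutcome_finalState (hE : Summable fun i => Real.exp (-β * E i))
    (hω : Summable fun n => Real.exp (-β * ω n)) (e : OrthonormalBasis σ ℂ (Hilb σ))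
    (U : unitary (Op (σ × ι))) (y : σ × ι) :
    jointOutcome e (finalState β E ω U) y =
      ∑ x : σ × ι, gibbsWeight β E x.1 * gibbsWeight β ω x.2 * transitionProb e U y x := by
  rw [jointOutcome, ← (hasSum_inner_finalState hE hω U _).tsum_eq, tsum_fintype]
  rfl

theorem jointOutcome_finalState_nonneg (hE : Summable fun i => Real.exp (-β * E i))
    (hω : Summable fun n => Real.exp (-β * ω n)) (e : OrthonormalBasis σ ℂ (Hilb σ))
    (U : unitary (Op (σ × ι))) (y : σ × ι) : 0 ≤ jointOutcome e (finalState β E ω U) y := by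
  rw [jointOutcome_finalState hE hω]
  exact Finset.sum_nonneg fun x _ => mul_nonneg
    (mul_nonneg (gibbsWeight_pos hE _).le (gibbsWeight_pos hω _).le) (sq_nonneg _)

theorem sum_jointOutcome_finalState (hE : Summable fun i => Real.exp (-β * E i))
    (hω : Summable fun n => Real.exp (-β * ω n)) (e : OrthonormalBasis σ ℂ (Hilb σ))
    (U : unitary (Op (σ × ι))) : ∑ y, jointOutcome e (finalState β E ω U) y = 1 := by
  simp only [jointOutcome_finalState hE hω]
  rw [Finset.sum_comm]
  simp only [← Finset.mul_sum, sum_transitionProb_left, mul_one]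
  rw [← (hasSum_jointWeight hE hω).tsum_eq, tsum_fintype]

/-- The populations of the energy levels of the machine after the process. -/
noncomputable def machinePopulation (β : ℝ) (E : σ → ℝ) (ω : ι → ℝ) (U : unitary (Op (σ × ι)))
    (n : ι) : ℝ :=
  (⟪ket n, traceFst (finalState β E ω U) (ket n)⟫_ℂ).re

theorem machinePopulation_nonneg (hE : Summable fun i => Real.exp (-β * E i))
    (hω : Summable fun n => Real.exp (-β * ω n)) (U : unitary (Op (σ × ι))) (n : ι) :
    0 ≤ machinePopulation β E ω U n := by
  rw [machinePopulation, ← sum_jointOutcome_fst (ketBasis σ)]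
  exact Finset.sum_nonneg fun a _ => jointOutcome_finalState_nonneg hE hω _ U _

theorem sum_machinePopulation (hE : Summable fun i => Real.exp (-β * E i))
    (hω : Summable fun n => Real.exp (-β * ω n)) (U : unitary (Op (σ × ι))) :
    ∑ n, machinePopulation β E ω U n = 1 := by
  simp only [machinePopulation, ← sum_jointOutcome_fst (ketBasis σ)]
  rw [← Fintype.sum_prod_type_right, sum_jointOutcome_finalState hE hω]

/-- The entropy balance of a process, in terms of measured populations. -/
theorem shannonEntropy_initial_le (hE : Summable fun i => Real.exp (-β * E i))
    (hω : Summable fun n => Real.exp (-β * ω n)) (e : OrthonormalBasis σ ℂ (Hilb σ))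
    (U : unitary (Op (σ × ι))) :
    shannonEntropy (gibbsWeight β E) + shannonEntropy (gibbsWeight β ω) ≤
      (shannonEntropy fun a => (⟪e a, traceSnd (finalState β E ω U) (e a)⟫_ℂ).re) +
        shannonEntropy (machinePopulation β E ω U) := by
  have hE1 := (hasSum_gibbsWeight hE).tsum_eq
  have hω1 := (hasSum_gibbsWeight hω).tsum_eq
  rw [tsum_fintype] at hE1 hω1
  -- The unitary and the final measurement mix the initial weights doubly stochastically;
  -- subadditivity then splits the outcomes into target and machine.
  have h1 := shannonEntropy_le_of_doublyStochastic (P := transitionProb e U)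
    (fun _ _ => sq_nonneg _) (sum_transitionProb_right e U) (sum_transitionProb_left e U)
    (w := fun x : σ × ι => gibbsWeight β E x.1 * gibbsWeight β ω x.2)
    (fun x => mul_nonneg (gibbsWeight_pos hE _).le (gibbsWeight_pos hω _).le)
  simp only [← jointOutcome_finalState hE hω] at h1
  have h2 := shannonEntropy_le_add_marginals (jointOutcome_finalState_nonneg hE hω e U)
    (sum_jointOutcome_finalState hE hω e U)
  simp only [sum_jointOutcome_fst, sum_jointOutcome_snd] at h2
  rw [shannonEntropy_mul hE1 hω1] at h1
  exact h1.trans h2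

/-- The logarithm of a Gibbs weight is affine in the energy, and the constant `log Z` cancels
because both populations are normalised. Adding `H(q) - H(r)` gives the relative entropy `D(r‖q)`.
-/
theorem mul_energyChange_eq (hE : Summable fun i => Real.exp (-β * E i))
    (hω : Summable fun n => Real.exp (-β * ω n)) (U : unitary (Op (σ × ι))) {Δ : ℝ}
    (hΔ : IsEnergyChange ω (gibbsState β ω) (traceFst (finalState β E ω U)) Δ) :
    β * Δ = -∑ n, machinePopulation β E ω U n * Real.log (gibbsWeight β ω n) -
      shannonEntropy (gibbsWeight β ω) := by
  have hω1 := (hasSum_gibbsWeight hω).tsum_eq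
  rw [tsum_fintype] at hω1
  have hM1 := sum_machinePopulation hE hω U
  have hq (n : ι) : (⟪ket n, gibbsState β ω (ket n)⟫_ℂ).re = gibbsWeight β ω n := by
    rw [gibbsState, diagOp_ket (hasSum_gibbsWeight hω).summable, inner_smul_right,
      inner_self_eq_norm_sq_to_K, norm_ket]
    simp
  have hΔ' : Δ = ∑ n, ω n * (machinePopulation β E ω U n - gibbsWeight β ω n) := by
    rw [← hΔ.tsum_eq, tsum_fintype]
    refine Finset.sum_congr rfl fun n _ => ?_
    rw [sub_apply, inner_sub_right, Complex.sub_re, hq, machinePopulation]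
  have h (n : ι) : β * (ω n * (machinePopulation β E ω U n - gibbsWeight β ω n)) =
      -(machinePopulation β E ω U n * Real.log (gibbsWeight β ω n)) -
        Real.negMulLog (gibbsWeight β ω n) -
        Real.log (partitionFunction β ω) * (machinePopulation β E ω U n - gibbsWeight β ω n) := by
    rw [Real.negMulLog, log_gibbsWeight hω]
    ring
  rw [hΔ', Finset.mul_sum, Finset.sum_congr rfl fun n _ => h n, Finset.sum_sub_distrib,
    ← Finset.mul_sum, Finset.sum_sub_distrib, Finset.sum_sub_distrib, hM1, hω1,
    Finset.sum_neg_distrib, shannonEntropy]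
  ring

end FiniteProcess

/-! ### Divergence of the dimension. -/

section Dimension

/-- Perfect cooling at the Landauer limit requires machines of diverging dimension. -/
theorem tendsto_hilbertDim_of_landauerCost {σ : Type*} [Nontrivial σ]
    {β : ℝ} {E : σ → ℝ} (hE : Summable fun i => Real.exp (-β * E i))
    {ι : ℕ → Type*} [∀ k, Nonempty (ι k)]
    {ω : ∀ k, ι k → ℝ} (hω : ∀ k, Summable fun n => Real.exp (-β * ω k n))
    (U : ∀ k, unitary (Op (σ × ι k)))
    (hcool : PerfectCooling fun k => traceSnd (finalState β E (ω k) (U k)))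
    (hcost : LandauerCost β E ω U) :
    Tendsto (fun k => hilbertDim (ι k)) atTop (𝓝 ⊤) := by
  rw [ENat.tendsto_nhds_top_iff_natCast_lt]
  intro D
  by_contra hD
  have hD : ∃ᶠ k in atTop, hilbertDim (ι k) ≤ D := by
    rw [not_eventually] at hD
    exact hD.mono fun k hk => not_lt.1 hk
  have := finite_target_of_frequently_card_le hE hω U hcool hD
  have := Fintype.ofFinite σ
  obtain ⟨ψ, hψ, hlim⟩ := hcool
  obtain ⟨-, -, ΔE, hΔE, hsat⟩ := hcost
  have hH := shannonEntropy_gibbsWeight_pos hE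
  set h := shannonEntropy (gibbsWeight β E) with hh
  obtain ⟨δ, hδ, hcontM⟩ :=
    exists_shannonEntropy_lt_of_sum_sqrt_sub_sqrt_sq_lt D (half_pos hH)
  -- The residual target entropy enters twice: `δ / 2` of it, with `δ / 2` from saturation, keeps
  -- the relative entropy below `δ`; the bound `h / 2` serves the final contradiction.
  obtain ⟨η, hη, hpure⟩ :=
    exists_shannonEntropy_lt_of_nearly_deterministic σ (lt_min (half_pos hH) (half_pos hδ))
  obtain ⟨k, hkD, hkψ, hkE⟩ := (hD.and_eventually ((hlim.eventually (gt_mem_nhds hη)).and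
    (hsat.eventually (gt_mem_nhds (half_pos hδ))))).exists
  have : Finite (ι k) := by
    rw [← ENat.card_lt_top]
    exact lt_of_le_of_lt hkD (ENat.natCast_lt_top D)
  have := Fintype.ofFinite (ι k)
  have hcard : Fintype.card (ι k) ≤ D := by
    rw [hilbertDim, ENat.card_eq_coe_fintype_card] at hkD
    exact_mod_cast hkD
  obtain ⟨e, a₀, he⟩ := exists_orthonormalBasis_apply_eq (hψ k)
  have hS : (shannonEntropy fun a =>
      (⟪e a, traceSnd (finalState β E (ω k) (U k)) (e a)⟫_ℂ).re) < min (h / 2) (δ / 2) := by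
    refine hpure _ a₀ ?_ fun a ha => ?_
    · rw [he]
      exact (abs_inner_sub_rankOne_le (hψ k)).trans_lt hkψ
    · refine (abs_inner_sub_rankOne_le_of_inner_eq_zero (e.orthonormal.1 a) ?_).trans_lt hkψ
      rw [← he]
      exact e.orthonormal.2 ha.symm
  obtain ⟨hS1, hS2⟩ := lt_min_iff.1 hS
  have hbal := shannonEntropy_initial_le hE (hω k) e (U k)
  have hen := mul_energyChange_eq hE (hω k) (U k) (hΔE k)
  have hω1 := (hasSum_gibbsWeight (hω k)).tsum_eq
  rw [tsum_fintype] at hω1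
  have hhell := sum_sqrt_sub_sqrt_sq_le (machinePopulation_nonneg hE (hω k) (U k))
    (gibbsWeight_pos (hω k)) (sum_machinePopulation hE (hω k) (U k)) hω1
  have hent := toReal_entropy_gibbsState_le hE
  have hent' : 0 ≤ (entropy (traceSnd (finalState β E (ω k) (U k)))).toReal :=
    ENNReal.toReal_nonneg
  -- The closing `linarith` shows `D(r‖q) < δ`. The final entropy of the target enters only through
  -- its nonnegativity.
  have hlt := hcontM (ι k) _ _ hcard (machinePopulation_nonneg hE (hω k) (U k))
    (fun n => (gibbsWeight_pos (hω k) n).le) (sum_machinePopulation hE (hω k) (U k)) hω1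
    (by linarith)
  -- Continuity gives `H(r) < H(q) + h / 2`, whereas the entropy balance requires `H(r) > H(q) + h /
  -- 2`.
  linarith

end Dimension

end LandauerCooling

theorem mainTheorem10 {σ : Type*} [Countable σ] [Nontrivial σ]
    (β : ℝ) (E : σ → ℝ) (hE : Summable fun i => Real.exp (-β * E i))
    (ι : ℕ → Type*) [∀ k, Countable (ι k)] [∀ k, Nonempty (ι k)]
    (ω : ∀ k, ι k → ℝ) (hω : ∀ k, Summable fun n => Real.exp (-β * ω k n))
    (U : ∀ k, unitary (LandauerCooling.Op (σ × ι k)))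
    (hcool : LandauerCooling.PerfectCooling fun k =>
      LandauerCooling.traceSnd (LandauerCooling.finalState β E (ω k) (U k)))
    (hcost : LandauerCooling.LandauerCost β E ω U) :
    Tendsto (fun k => LandauerCooling.hilbertDim (ι k)) atTop (𝓝 ⊤) ∧
      Tendsto (fun k => LandauerCooling.maxEnergyGap (ω k)) atTop (𝓝 ⊤) :=
  ⟨LandauerCooling.tendsto_hilbertDim_of_landauerCost hE hω U hcool hcost,
    LandauerCooling.tendsto_maxEnergyGap_of_perfectCooling hE hω U hcool⟩
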